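/- Let $n$ be a positive integer and let $S\subseteq(\mathbb Z/n\mathbb Z)\setminus\{0\}$ satisfy $-S=S$. Let $\mathrm{Circ}(n,S)$ be the graph with vertex set $\mathbb Z/n\mathbb Z=\{0,1,\dots,n-1\}$ in which $i$ and $j$ are adjacent if and only if $i-j\in S$. It is called a consecutive circulant if $S=\{\pm1,\pm2,\dots,\pm k\}$ (modulo $n$) for some integer $k$ with $1\le k\le\lfloor n/2\rfloor$. An $n\times n$ matrix $A$, with rows and columns indexed by $\mathbb Z/n\mathbb Z$, is a circulant matrix if $A_{ij}$ depends only on $i-j$ modulo $n$, and $A$ has graph $G$ if for all $i\neq j$ we have $A_{ij}\ne0$ exactly when $i$ and $j$ are adjacent in $G$. For a circulant graph $G=\mathrm{Circ}(n,S)$, let $\mathrm{mscr}(G)$ be the smallest rank of a positive semidefinite complex Hermitian circulant matrix with graph $G$, and let $\mathrm{mscr}^{\mathbb R}(G)$ be the smallest rank of a positive semidefinite real symmetric circulant matrix with graph $G$. **Theorem.** If $G=\mathrm{Circ}(n,S)$ is a consecutive circulant and $n$ is odd, then $$\mathrm{mscr}^{\mathbb R}(G)=\mathrm{mscr}(G)=n-|S|.$$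 -/

import Mathlib

open scoped ComplexOrder

namespace CirculantRank

/-- The set `{±1, ±2, …, ±k}` of residues modulo `n`. -/
def consecutiveSet (n k : ℕ) : Finset (ZMod n) :=
  (Finset.Icc 1 k).image (fun j : ℕ => (j : ZMod n)) ∪
    (Finset.Icc 1 k).image (fun j : ℕ => -(j : ZMod n))

/-- `G`, on the vertex set `ℤ/nℤ = {0, 1, …, n - 1}`, is a consecutive circulant:
`G = Circ(n, {±1, …, ±k})` for some `1 ≤ k ≤ ⌊n/2⌋`. -/
def IsConsecutiveCirculant {n : ℕ} (G : SimpleGraph (ZMod n)) : Prop :=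
  ∃ k : ℕ, 1 ≤ k ∧ k ≤ n / 2 ∧
    G = SimpleGraph.circulantGraph (consecutiveSet n k : Set (ZMod n))

/-- `G` is the graph of the matrix `A`: the off-diagonal nonzero entries of `A` are located
exactly at the edges of `G`. The diagonal is unrestricted. -/
def IsGraphOf {V K : Type*} [Zero K] (G : SimpleGraph V) (A : Matrix V V K) : Prop :=
  ∀ i j : V, i ≠ j → (G.Adj i j ↔ A i j ≠ 0)

/-- `A` is a circulant matrix: the entry `A i j` depends only on `i - j` modulo `n`. -/
def IsCirculantMatrix {n : ℕ} {K : Type*} (A : Matrix (ZMod n) (ZMod n) K) : Prop :=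
  ∃ b : ZMod n → K, A = Matrix.circulant b

/-- The positive semidefinite matrices over `K` with graph `G`. Positive semidefinite matrices are
Hermitian by definition; over `ℝ` this means symmetric. -/
def psdMatrices (K : Type*) [Field K] [PartialOrder K] [StarRing K] {V : Type*}
    (G : SimpleGraph V) : Set (Matrix V V K) :=
  {A | A.PosSemidef ∧ IsGraphOf G A}

/-- The minimum semidefinite circulant rank over `K`: the smallest rank of a positive semidefinite
circulant matrix over `K` with graph `G`. -/
noncomputable def minSemidefiniteCirculantRank (K : Type*) [Field K] [PartialOrder K] [StarRing K]
    {n : ℕ} [NeZero n] (G : SimpleGraph (ZMod n)) : ℕ :=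
  sInf {r : ℕ | ∃ A : Matrix (ZMod n) (ZMod n) K,
    A ∈ psdMatrices K G ∧ IsCirculantMatrix A ∧ A.rank = r}

/-- `mscr(G)`, over complex Hermitian matrices. -/
noncomputable abbrev mscr {n : ℕ} [NeZero n] (G : SimpleGraph (ZMod n)) : ℕ :=
  minSemidefiniteCirculantRank ℂ G

/-- `mscr^ℝ(G)`, over real symmetric matrices. -/
noncomputable abbrev mscrReal {n : ℕ} [NeZero n] (G : SimpleGraph (ZMod n)) : ℕ :=
  minSemidefiniteCirculantRank ℝ G

end CirculantRank

namespace CirculantRank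

/-- Membership in `{±1, …, ±k}` in terms of the representatives `0, 1, …, n - 1`. -/
theorem natCast_mem_consecutiveSet {n k t : ℕ} (hk : k < n) (ht : t < n) :
    (t : ZMod n) ∈ consecutiveSet n k ↔ (1 ≤ t ∧ t ≤ k) ∨ (n - k ≤ t) := by
  simp only [consecutiveSet, Finset.mem_union, Finset.mem_image, Finset.mem_Icc]
  constructor
  · rintro (⟨j, hj, h⟩ | ⟨j, hj, h⟩)
    · left
      rw [ZMod.natCast_eq_natCast_iff'] at h
      rw [Nat.mod_eq_of_lt (by omega), Nat.mod_eq_of_lt ht] at h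
      omega
    · right
      have h' : ((j + t : ℕ) : ZMod n) = 0 := by
        rw [Nat.cast_add, ← h]; ring
      rw [ZMod.natCast_eq_zero_iff] at h'
      have := Nat.le_of_dvd (by omega) h'
      omega
  · rintro (h | h)
    · exact Or.inl ⟨t, h, rfl⟩
    · refine Or.inr ⟨n - t, by omega, ?_⟩
      rw [Nat.cast_sub ht.le]
      simp

theorem card_consecutiveSet {n k : ℕ} [NeZero n] (hk : 2 * k < n) :
    (consecutiveSet n k).card = 2 * k := by
  have h : consecutiveSet n k =
      (Finset.Icc 1 k ∪ Finset.Ico (n - k) n).image (fun t : ℕ => (t : ZMod n)) := by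
    ext d
    have hd := d.val_lt
    rw [← ZMod.natCast_zmod_val d, natCast_mem_consecutiveSet (by omega) hd]
    simp only [Finset.mem_image, Finset.mem_union, Finset.mem_Icc, Finset.mem_Ico]
    constructor
    · intro h
      exact ⟨d.val, by omega, rfl⟩
    · rintro ⟨t, ht, h⟩
      rw [ZMod.natCast_eq_natCast_iff', Nat.mod_eq_of_lt (by omega), Nat.mod_eq_of_lt hd] at h
      omega
  rw [h, Finset.card_image_of_injOn, Finset.card_union_of_disjoint]
  · simp only [Nat.card_Icc, Nat.card_Ico]
    omega
  · rw [Finset.disjoint_left]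
    intro a ha hb
    simp only [Finset.mem_Icc, Finset.mem_Ico] at ha hb
    omega
  · intro a ha b hb hab
    simp only [Finset.coe_union, Finset.coe_Icc, Finset.coe_Ico, Set.mem_union, Set.mem_Icc,
      Set.mem_Ico] at ha hb
    simp only [ZMod.natCast_eq_natCast_iff'] at hab
    rwa [Nat.mod_eq_of_lt (by omega), Nat.mod_eq_of_lt (by omega)] at hab

theorem neg_mem_consecutiveSet {n k : ℕ} {d : ZMod n} (hd : d ∈ consecutiveSet n k) :
    -d ∈ consecutiveSet n k := by
  simp only [consecutiveSet, Finset.mem_union, Finset.mem_image] at hd ⊢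
  rcases hd with ⟨j, hj, rfl⟩ | ⟨j, hj, rfl⟩
  · exact Or.inr ⟨j, hj, rfl⟩
  · exact Or.inl ⟨j, hj, (neg_neg _).symm⟩

theorem zero_notMem_consecutiveSet {n k : ℕ} (hk : k < n) :
    (0 : ZMod n) ∉ consecutiveSet n k := by
  have := (natCast_mem_consecutiveSet (t := 0) hk (by omega)).not
  rw [Nat.cast_zero] at this
  rw [this]
  omega

/-- A symmetric connection set avoiding `0` is determined by its circulant graph. -/
theorem eq_of_circulantGraph_eq {G : Type*} [AddGroup G] {S T : Finset G}
    (hS0 : 0 ∉ S) (hS : ∀ s ∈ S, -s ∈ S) (hT0 : 0 ∉ T) (hT : ∀ s ∈ T, -s ∈ T)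
    (h : SimpleGraph.circulantGraph (S : Set G) = SimpleGraph.circulantGraph (T : Set G)) :
    S = T := by
  ext d
  by_cases hd : d = 0
  · simp [hd, hS0, hT0]
  have hneg {U : Finset G} (hU : ∀ s ∈ U, -s ∈ U) : -d ∈ U → d ∈ U := fun h => by
    simpa using hU _ h
  have := congrArg (fun H => H.Adj d 0) h
  simp only [SimpleGraph.circulantGraph_adj, sub_zero, zero_sub, Finset.mem_coe, eq_iff_iff] at this
  have h1 := hneg hS
  have h2 := hneg hT
  tauto

theorem circulantGraph_consecutiveSet_adj {n k : ℕ} {i j : ZMod n} (hij : i ≠ j) :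
    (SimpleGraph.circulantGraph (consecutiveSet n k : Set (ZMod n))).Adj i j ↔
      i - j ∈ consecutiveSet n k := by
  have := neg_mem_consecutiveSet (n := n) (k := k) (d := j - i)
  rw [neg_sub] at this
  simp only [SimpleGraph.circulantGraph_adj, Finset.mem_coe]
  tauto

/-- Any matrix with the graph of a consecutive circulant has rank at least `n - 2 * k`. -/
theorem le_rank_of_isGraphOf {K : Type*} [Field K] {n k : ℕ} [NeZero n] (hk1 : 1 ≤ k)
    (hk : 2 * k < n) {A : Matrix (ZMod n) (ZMod n) K}
    (hA : IsGraphOf (SimpleGraph.circulantGraph (consecutiveSet n k : Set (ZMod n))) A) :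
    n - 2 * k ≤ A.rank := by
  have key (i j : Fin (n - 2 * k)) (hij : j ≤ i) :
      A (((i : ℕ) + k : ℕ) : ZMod n) ((j : ℕ) : ZMod n) ≠ 0 ↔ i - (j : ℕ) + k ≤ k := by
    have hi := i.2
    have hj := j.2
    have hij' : (j : ℕ) ≤ i := hij
    have hsub : (((i : ℕ) + k : ℕ) : ZMod n) - ((j : ℕ) : ZMod n) =
        ((i - (j : ℕ) + k : ℕ) : ZMod n) := by
      push_cast [Nat.cast_sub hij']
      ring
    have hne : (((i : ℕ) + k : ℕ) : ZMod n) ≠ ((j : ℕ) : ZMod n) := by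
      rw [Ne, ZMod.natCast_eq_natCast_iff', Nat.mod_eq_of_lt (by omega),
        Nat.mod_eq_of_lt (by omega)]
      omega
    rw [← hA _ _ hne, circulantGraph_consecutiveSet_adj hne, hsub,
      natCast_mem_consecutiveSet (by omega) (by omega)]
    omega
  let B := A.submatrix (fun i : Fin (n - 2 * k) => (((i : ℕ) + k : ℕ) : ZMod n))
    (fun j : Fin (n - 2 * k) => ((j : ℕ) : ZMod n))
  have hB : B.BlockTriangular id := by
    intro i j hij
    have hij' : (j : ℕ) < i := hij
    by_contra h
    have := (key i j hij.le).1 h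
    omega
  have hdet : B.det ≠ 0 := by
    rw [Matrix.det_of_isUpperTriangular hB]
    exact Finset.prod_ne_zero_iff.2 fun i _ => (key i i le_rfl).2 (by omega)
  have := Matrix.rank_of_det_ne_zero hdet
  rw [Fintype.card_fin] at this
  rw [← this]
  exact A.rank_submatrix_le _ _

open ZMod in
theorem re_stdAddChar_natCast {n : ℕ} [NeZero n] (t : ℕ) :
    (stdAddChar (t : ZMod n)).re = Real.cos (2 * Real.pi * t / n) := by
  have h := stdAddChar_coe (N := n) (t : ℤ)
  rw [Int.cast_natCast] at h
  rw [h, ← Complex.exp_ofReal_mul_I_re]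
  congr 2
  push_cast
  ring

open ZMod in
theorem stdAddChar_neg_eq_conj {n : ℕ} [NeZero n] (m : ZMod n) :
    stdAddChar (-m) = (starRingEnd ℂ) (stdAddChar m) :=
  AddChar.map_neg_eq_conj _ m

open ZMod in
theorem ofReal_re_stdAddChar {n : ℕ} [NeZero n] (m : ZMod n) :
    ((stdAddChar m).re : ℂ) = (stdAddChar m + stdAddChar (-m)) / 2 := by
  rw [stdAddChar_neg_eq_conj, Complex.re_eq_add_conj]

open ZMod in
theorem re_stdAddChar_strictAnti {n s t : ℕ} [NeZero n] (hst : s < t) (ht : 2 * t ≤ n) :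
    (stdAddChar (t : ZMod n)).re < (stdAddChar (s : ZMod n)).re := by
  have hn : (0 : ℝ) < n := by exact_mod_cast NeZero.pos n
  have hst' : (s : ℝ) < t := by exact_mod_cast hst
  have ht' : (2 : ℝ) * t ≤ n := by exact_mod_cast ht
  have hpi := Real.pi_pos
  rw [re_stdAddChar_natCast, re_stdAddChar_natCast]
  apply Real.cos_lt_cos_of_nonneg_of_le_pi
  · positivity
  · rw [div_le_iff₀ hn]
    nlinarith
  · gcongr

/-- The trigonometric polynomial `∏ (cos θ - cos θ_j)` over `h - k < j ≤ h` with `θ_j = 2πj/n`,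
evaluated at `θ = 2πm/n`. -/
noncomputable def eigenvalueWeight (n h k : ℕ) [NeZero n] (m : ZMod n) : ℝ :=
  ∏ j ∈ Finset.Ioc (h - k) h,
    ((ZMod.stdAddChar m).re - (ZMod.stdAddChar (j : ZMod n)).re)

theorem natCast_self_sub {n t : ℕ} (ht : t ≤ n) : ((n - t : ℕ) : ZMod n) = -(t : ZMod n) := by
  rw [Nat.cast_sub ht, ZMod.natCast_self, zero_sub]

section eigenvalueWeight

variable {n h k : ℕ} [NeZero n]

theorem eigenvalueWeight_neg (m : ZMod n) :
    eigenvalueWeight n h k (-m) = eigenvalueWeight n h k m := by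
  simp only [eigenvalueWeight, stdAddChar_neg_eq_conj, Complex.conj_re]

theorem eigenvalueWeight_natCast_pos (hn : n = 2 * h + 1) {t : ℕ} (ht : t ≤ h - k) :
    0 < eigenvalueWeight n h k (t : ZMod n) := by
  refine Finset.prod_pos fun j hj => ?_
  rw [Finset.mem_Ioc] at hj
  exact sub_pos.2 (re_stdAddChar_strictAnti (by omega) (by omega))

theorem eigenvalueWeight_natCast_eq_zero (hn : n = 2 * h + 1) (hk : k ≤ h) {t : ℕ}
    (ht : h - k < t) (ht' : t ≤ h + k) :
    eigenvalueWeight n h k (t : ZMod n) = 0 := by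
  have aux {s : ℕ} (hs : h - k < s) (hs' : s ≤ h) : eigenvalueWeight n h k (s : ZMod n) = 0 :=
    Finset.prod_eq_zero (Finset.mem_Ioc.2 ⟨hs, hs'⟩) (sub_self _)
  rcases le_or_gt t h with hth | hth
  · exact aux ht hth
  · rw [← eigenvalueWeight_neg, ← natCast_self_sub (by omega)]
    exact aux (by omega) (by omega)

theorem eigenvalueWeight_nonneg (hn : n = 2 * h + 1) (hk : k ≤ h) (m : ZMod n) :
    0 ≤ eigenvalueWeight n h k m := by
  have hm := m.val_lt
  rw [← ZMod.natCast_zmod_val m]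
  generalize m.val = t at hm
  rcases le_or_gt t (h - k) with h1 | h1
  · exact (eigenvalueWeight_natCast_pos hn h1).le
  rcases le_or_gt t (h + k) with h2 | h2
  · exact (eigenvalueWeight_natCast_eq_zero hn hk h1 h2).ge
  · rw [← eigenvalueWeight_neg, ← natCast_self_sub (by omega)]
    exact (eigenvalueWeight_natCast_pos hn (by omega)).le

theorem card_eigenvalueWeight_ne_zero_le (hn : n = 2 * h + 1) (hk : k ≤ h) :
    Fintype.card {m : ZMod n // eigenvalueWeight n h k m ≠ 0} ≤ n - 2 * k := by
  classical
  have hsub : (Finset.univ.filter fun m : ZMod n => eigenvalueWeight n h k m ≠ 0) ⊆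
      (Finset.range n \ Finset.Ioc (h - k) (h + k)).image (fun t : ℕ => (t : ZMod n)) := by
    intro m hm
    rw [Finset.mem_filter] at hm
    refine Finset.mem_image.2 ⟨m.val, ?_, ZMod.natCast_zmod_val m⟩
    rw [Finset.mem_sdiff, Finset.mem_range, Finset.mem_Ioc]
    refine ⟨m.val_lt, fun hmem => hm.2 ?_⟩
    rw [← ZMod.natCast_zmod_val m]
    exact eigenvalueWeight_natCast_eq_zero hn hk hmem.1 hmem.2
  rw [Fintype.card_subtype]
  refine (Finset.card_le_card hsub).trans (Finset.card_image_le.trans ?_)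
  rw [Finset.card_sdiff_of_subset, Finset.card_range, Nat.card_Ioc]
  · omega
  · intro t ht
    rw [Finset.mem_Ioc] at ht
    rw [Finset.mem_range]
    omega

end eigenvalueWeight

open ZMod in
theorem dft_one_eq_zero {n : ℕ} [NeZero n] {d : ZMod n} (hd : d ≠ 0) :
    ZMod.dft (fun _ : ZMod n => (1 : ℂ)) d = 0 := by
  rw [dft_apply]
  have := AddChar.sum_mulShift (-d) (isPrimitive_stdAddChar n)
  rw [if_neg (neg_ne_zero.2 hd)] at this
  simpa [mul_neg] using this

open ZMod in
theorem dft_mul_re_stdAddChar_sub {n : ℕ} [NeZero n] (Φ : ZMod n → ℂ) (x : ℝ) (d : ZMod n) :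
    ZMod.dft (fun m => (((stdAddChar m).re - x : ℝ) : ℂ) * Φ m) d =
      (ZMod.dft Φ (d - 1) + ZMod.dft Φ (d + 1)) / 2 - x * ZMod.dft Φ d := by
  simp only [dft_apply, smul_eq_mul, ← Finset.sum_add_distrib, Finset.sum_div, Finset.mul_sum,
    ← Finset.sum_sub_distrib]
  refine Finset.sum_congr rfl fun m _ => ?_
  have h1 : -(m * (d - 1)) = m + -(m * d) := by ring
  have h2 : -(m * (d + 1)) = -m + -(m * d) := by ring
  rw [h1, h2, AddChar.map_add_eq_mul, AddChar.map_add_eq_mul, Complex.ofReal_sub,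
    ofReal_re_stdAddChar]
  ring

/-- The Fourier transform of a trigonometric polynomial of degree `r` is supported on
`{-r, …, r}`. -/
theorem exists_abs_le_of_dft_prod_ne_zero {n : ℕ} [NeZero n] (J : Finset ℕ) (x : ℕ → ℝ)
    (d : ZMod n)
    (hd : ZMod.dft (fun m => ((∏ j ∈ J, ((ZMod.stdAddChar m).re - x j) : ℝ) : ℂ)) d ≠ 0) :
    ∃ t : ℤ, |t| ≤ J.card ∧ d = t := by
  induction J using Finset.induction_on generalizing d with
  | empty =>
    by_contra hcon
    refine hd ?_
    simp only [Finset.prod_empty, Complex.ofReal_one]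
    exact dft_one_eq_zero fun h0 => hcon ⟨0, by simp [h0]⟩
  | insert a J ha ih =>
    simp only [Finset.prod_insert ha] at hd
    simp only [Complex.ofReal_mul (_ - _) _] at hd
    rw [dft_mul_re_stdAddChar_sub] at hd
    rw [Finset.card_insert_of_notMem ha, Nat.cast_succ]
    by_contra hcon
    refine hd ?_
    have key (e : ZMod n) (s : ℤ) (hs : |s| ≤ 1) (he : d = e + s) :
        ZMod.dft (fun m => ((∏ j ∈ J, ((ZMod.stdAddChar m).re - x j) : ℝ) : ℂ)) e = 0 := by
      by_contra hne
      obtain ⟨t, ht, rfl⟩ := ih e hne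
      exact hcon ⟨t + s, (abs_add_le t s).trans (by omega), by rw [he]; push_cast; rfl⟩
    rw [key (d - 1) 1 (by simp) (by simp), key (d + 1) (-1) (by simp) (by simp),
      key d 0 (by simp) (by simp)]
    simp

/-- A function on `ℤ/nℤ` supported on `2 * k` of the residues `-k, …, k` whose Fourier transform
vanishes at `2 * k` consecutive points is zero. -/
theorem eq_zero_of_dft_eq_zero {n k : ℕ} [NeZero n] (hk : 2 * k < n) (Ψ : ZMod n → ℂ)
    (hsupp : ∀ d, Ψ d ≠ 0 → ∃ t : ℤ, |t| ≤ k ∧ d = t) {t₀ : ℤ} (ht₀ : |t₀| ≤ k)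
    (hΨ : Ψ t₀ = 0) (a : ZMod n) (ha : ∀ s < 2 * k, ZMod.dft Ψ (a + s) = 0) : Ψ = 0 := by
  rw [abs_le] at ht₀
  let g : Fin (2 * k + 1) → ZMod n := fun i => ((i : ℤ) - k : ℤ)
  have hg : Function.Injective g := by
    intro i j hij
    have hi := i.2
    have hj := j.2
    have h := (ZMod.intCast_eq_intCast_iff_dvd_sub _ _ _).1 hij
    have := Int.eq_zero_of_abs_lt_dvd h (by rw [abs_lt]; omega)
    ext
    omega
  have hrange (d : ZMod n) (hd : Ψ d ≠ 0) : ∃ i, g i = d := by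
    obtain ⟨t, ht, rfl⟩ := hsupp d hd
    rw [abs_le] at ht
    refine ⟨⟨(t + k).toNat, by omega⟩, ?_⟩
    simp only [g]
    congr 1
    omega
  let p : Fin (2 * k + 1) := ⟨(t₀ + k).toNat, by omega⟩
  have hp : Ψ (g p) = 0 := by
    rw [← hΨ]
    simp only [g, p]
    congr 2
    omega
  have hv : (fun j : Fin (2 * k) =>
      ZMod.stdAddChar (-(g (p.succAbove j) * a)) * Ψ (g (p.succAbove j))) = 0 := by
    refine Matrix.eq_zero_of_forall_pow_sum_mul_pow_eq_zero
      (f := fun j => ZMod.stdAddChar (-g (p.succAbove j))) ?_ ?_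
    · exact ZMod.injective_stdAddChar.comp
        (neg_injective.comp (hg.comp Fin.succAbove_right_injective))
    · intro s
      have h := ha s s.2
      rw [ZMod.dft_apply] at h
      rw [← h]
      rw [← Finset.sum_subset (Finset.subset_univ (Finset.univ.image g)),
        Finset.sum_image (fun _ _ _ _ e => hg e), Fin.sum_univ_succAbove _ p, hp, smul_zero,
        zero_add]
      · refine Finset.sum_congr rfl fun j _ => ?_
        have : -(g (p.succAbove j) * (a + (s : ℕ))) =
            -(g (p.succAbove j) * a) + (s : ℕ) • (-g (p.succAbove j)) := by
          rw [nsmul_eq_mul]; ring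
        rw [this, AddChar.map_add_eq_mul, AddChar.map_nsmul_eq_pow, smul_eq_mul]
        ring
      · intro d _ hd
        by_contra hne
        obtain ⟨i, hi⟩ := hrange d fun h0 => hne (by rw [h0, smul_zero])
        exact hd (Finset.mem_image.2 ⟨i, Finset.mem_univ _, hi⟩)
  funext d
  by_contra hne
  obtain ⟨i, rfl⟩ := hrange d hne
  rcases eq_or_ne i p with rfl | hip
  · exact hne hp
  obtain ⟨j, rfl⟩ := Fin.exists_succAbove_eq hip
  have := congrFun hv j
  rcases mul_eq_zero.1 this with h | h
  · exact (AddChar.val_isUnit _ _).ne_zero h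
  · exact hne h

theorem dft_eigenvalueWeight_ne_zero_iff {n h k : ℕ} [NeZero n] (hn : n = 2 * h + 1) (hk : k ≤ h)
    (d : ZMod n) :
    ZMod.dft (fun m => (eigenvalueWeight n h k m : ℂ)) d ≠ 0 ↔ ∃ t : ℤ, |t| ≤ k ∧ d = t := by
  have hsupp (d : ZMod n)
      (hd : ZMod.dft (fun m => (eigenvalueWeight n h k m : ℂ)) d ≠ 0) :
      ∃ t : ℤ, |t| ≤ k ∧ d = t := by
    have := exists_abs_le_of_dft_prod_ne_zero _ _ d hd
    rwa [Nat.card_Ioc, Nat.sub_sub_self hk] at this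
  refine ⟨hsupp d, ?_⟩
  rintro ⟨t, ht, rfl⟩ h0
  have hzero := eq_zero_of_dft_eq_zero (by omega) _ hsupp ht h0 ((h - k + 1 : ℕ) : ZMod n)
    (fun s hs => by
      rw [ZMod.dft_dft, ← Nat.cast_add]
      simp only [eigenvalueWeight_neg]
      rw [eigenvalueWeight_natCast_eq_zero hn hk (by omega) (by omega)]
      simp)
  rw [LinearEquiv.map_eq_zero_iff] at hzero
  have h1 := congrFun hzero ((0 : ℕ) : ZMod n)
  have h2 := eigenvalueWeight_natCast_pos (k := k) hn (Nat.zero_le (h - k))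
  simp only [Pi.zero_apply, Complex.ofReal_eq_zero] at h1
  exact h2.ne' h1

theorem exists_abs_le_iff_mem_consecutiveSet {n k : ℕ} {d : ZMod n} (hd : d ≠ 0) :
    (∃ t : ℤ, |t| ≤ k ∧ d = t) ↔ d ∈ consecutiveSet n k := by
  simp only [consecutiveSet, Finset.mem_union, Finset.mem_image, Finset.mem_Icc]
  constructor
  · rintro ⟨t, ht, rfl⟩
    have ht0 : t ≠ 0 := by rintro rfl; simp at hd
    rw [abs_le] at ht
    rcases lt_or_gt_of_ne ht0 with hlt | hgt
    · refine Or.inr ⟨(-t).toNat, by omega, ?_⟩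
      rw [← Int.cast_natCast, Int.toNat_of_nonneg (by omega)]
      simp
    · refine Or.inl ⟨t.toNat, by omega, ?_⟩
      rw [← Int.cast_natCast, Int.toNat_of_nonneg (by omega)]
  · rintro (⟨j, hj, rfl⟩ | ⟨j, hj, rfl⟩)
    · exact ⟨j, by rw [abs_le]; omega, by simp⟩
    · exact ⟨-j, by rw [abs_le]; omega, by simp⟩

/-- The discrete Hartley kernel `cos (2πij/n) + sin (2πij/n)`. -/
noncomputable def hartleyMatrix (n : ℕ) [NeZero n] : Matrix (ZMod n) (ZMod n) ℝ :=
  Matrix.of fun i j => (ZMod.stdAddChar (i * j)).re + (ZMod.stdAddChar (i * j)).im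

theorem sum_hartleyMatrix_mul_eq {n : ℕ} [NeZero n] (w : ZMod n → ℝ) (hw : ∀ m, w (-m) = w m)
    (i j : ZMod n) :
    ((∑ m, w m * (hartleyMatrix n i m * hartleyMatrix n j m) : ℝ) : ℂ) =
      ZMod.dft (fun m => (w m : ℂ)) (i - j) := by
  have hodd : ∑ m, w m * (ZMod.stdAddChar (m * (i + j))).im = 0 := by
    have h : ∑ m, w m * (ZMod.stdAddChar (m * (i + j))).im =
        -∑ m, w m * (ZMod.stdAddChar (m * (i + j))).im := by
      conv_lhs => rw [← Equiv.sum_comp (Equiv.neg (ZMod n))]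
      simp [hw, neg_mul, stdAddChar_neg_eq_conj]
    linarith
  have him : ∑ m, w m * (ZMod.stdAddChar (-(m * (i - j)))).im = 0 := by
    have h : ∑ m, w m * (ZMod.stdAddChar (-(m * (i - j)))).im =
        -∑ m, w m * (ZMod.stdAddChar (-(m * (i - j)))).im := by
      conv_lhs => rw [← Equiv.sum_comp (Equiv.neg (ZMod n))]
      simp [hw, neg_mul, stdAddChar_neg_eq_conj]
    linarith
  have hterm (m : ZMod n) : hartleyMatrix n i m * hartleyMatrix n j m =
      (ZMod.stdAddChar (-(m * (i - j)))).re + (ZMod.stdAddChar (m * (i + j))).im := by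
    have h1 : -(m * (i - j)) = -(i * m) + j * m := by ring
    have h2 : m * (i + j) = i * m + j * m := by ring
    rw [h1, h2, AddChar.map_add_eq_mul, AddChar.map_add_eq_mul, stdAddChar_neg_eq_conj]
    simp only [hartleyMatrix, Matrix.of_apply, Complex.mul_re, Complex.mul_im, Complex.conj_re,
      Complex.conj_im]
    ring
  have hre : ∑ m, w m * (hartleyMatrix n i m * hartleyMatrix n j m) =
      ∑ m, w m * (ZMod.stdAddChar (-(m * (i - j)))).re := by
    simp only [hterm, mul_add (w _), Finset.sum_add_distrib, hodd, add_zero]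
  rw [hre, ZMod.dft_apply]
  apply Complex.ext
  · simp [Complex.re_sum, mul_comm]
  · rw [Complex.ofReal_im, Complex.im_sum]
    simpa [mul_comm] using him.symm

/-- A real Gram factor of the circulant matrix with eigenvalues `eigenvalueWeight n h k`. -/
noncomputable def gramFactor (n h k : ℕ) [NeZero n] : Matrix (ZMod n) (ZMod n) ℝ :=
  hartleyMatrix n * Matrix.diagonal fun m => √(eigenvalueWeight n h k m)

theorem gramFactor_mul_transpose_apply {n h k : ℕ} [NeZero n] (hn : n = 2 * h + 1) (hk : k ≤ h)
    (i j : ZMod n) :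
    (((gramFactor n h k * (gramFactor n h k).transpose) i j : ℝ) : ℂ) =
      ZMod.dft (fun m => (eigenvalueWeight n h k m : ℂ)) (i - j) := by
  rw [← sum_hartleyMatrix_mul_eq _ eigenvalueWeight_neg, Matrix.mul_apply]
  congr 1
  refine Finset.sum_congr rfl fun m _ => ?_
  have := Real.mul_self_sqrt (eigenvalueWeight_nonneg hn hk m)
  simp only [gramFactor, Matrix.transpose_apply, Matrix.mul_diagonal]
  linear_combination (hartleyMatrix n i m * hartleyMatrix n j m) * this

/-- Over `ℝ` or `ℂ` there is a positive semidefinite circulant matrix of rank at most `n - 2 * k`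
whose graph is the consecutive circulant with parameter `k`. -/
theorem exists_circulant_rank_le (K : Type*) [RCLike K] {n k : ℕ} [NeZero n] (hn : Odd n)
    (hk : k ≤ n / 2) :
    ∃ A : Matrix (ZMod n) (ZMod n) K,
      A ∈ psdMatrices K (SimpleGraph.circulantGraph (consecutiveSet n k : Set (ZMod n))) ∧
        IsCirculantMatrix A ∧ A.rank ≤ n - 2 * k := by
  obtain ⟨h, hn⟩ := hn
  have hkh : k ≤ h := by omega
  let M : Matrix (ZMod n) (ZMod n) K := (gramFactor n h k).map (algebraMap ℝ K)
  have hM : M * M.conjTranspose =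
      (gramFactor n h k * (gramFactor n h k).transpose).map (algebraMap ℝ K) := by
    rw [Matrix.map_mul]
    congr 1
    ext i j
    simp [M]
  have hentry := gramFactor_mul_transpose_apply (n := n) hn hkh
  refine ⟨M * M.conjTranspose, ⟨Matrix.posSemidef_self_mul_conjTranspose M, ?_⟩, ?_, ?_⟩
  · intro i j hij
    rw [circulantGraph_consecutiveSet_adj hij,
      ← exists_abs_le_iff_mem_consecutiveSet (sub_ne_zero.2 hij),
      ← dft_eigenvalueWeight_ne_zero_iff hn hkh, ← hentry, hM, Matrix.map_apply,
      Complex.ofReal_ne_zero, Ne, Ne, map_eq_zero_iff _ (algebraMap ℝ K).injective]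
  · refine ⟨fun d => (M * M.conjTranspose) d 0, ?_⟩
    ext i j
    have : (gramFactor n h k * (gramFactor n h k).transpose) i j =
        (gramFactor n h k * (gramFactor n h k).transpose) (i - j) 0 := by
      rw [← Complex.ofReal_inj, hentry, hentry, sub_zero]
    rw [Matrix.circulant_apply, hM, Matrix.map_apply, Matrix.map_apply, this]
  · refine (Matrix.rank_mul_le_left _ _).trans ?_
    have hfac : M = (hartleyMatrix n).map (algebraMap ℝ K) *
        Matrix.diagonal fun m => algebraMap ℝ K √(eigenvalueWeight n h k m) := by
      simp only [M, gramFactor, Matrix.map_mul, Matrix.diagonal_map (map_zero _)]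
    rw [hfac]
    classical
    refine (Matrix.rank_mul_le_right _ _).trans ?_
    rw [Matrix.rank_diagonal]
    refine le_trans (Fintype.card_le_of_injective (Subtype.map id fun m hm h0 => hm ?_)
      (Subtype.map_injective _ Function.injective_id))
      (card_eigenvalueWeight_ne_zero_le hn hkh)
    rw [id] at h0
    rw [h0, Real.sqrt_zero, map_zero]

theorem minSemidefiniteCirculantRank_consecutiveSet (K : Type*) [RCLike K] {n k : ℕ} [NeZero n]
    (hn : Odd n) (hk1 : 1 ≤ k) (hk : k ≤ n / 2) :
    minSemidefiniteCirculantRank K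
      (SimpleGraph.circulantGraph (consecutiveSet n k : Set (ZMod n))) = n - 2 * k := by
  have hkn : 2 * k < n := by
    obtain ⟨h, rfl⟩ := hn
    omega
  obtain ⟨A, hA, hcirc, hrank⟩ := exists_circulant_rank_le K hn hk
  apply le_antisymm
  · refine le_trans (Nat.sInf_le ?_) hrank
    exact ⟨A, hA, hcirc, rfl⟩
  · refine le_csInf ⟨_, A, hA, hcirc, rfl⟩ ?_
    rintro r ⟨B, hB, -, rfl⟩
    exact le_rank_of_isGraphOf hk1 hkn hB.2

end CirculantRank

theorem mainTheorem6 (n : ℕ) [NeZero n] (hn : Odd n) (S : Finset (ZMod n))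
    (hS0 : (0 : ZMod n) ∉ S) (hSneg : ∀ s ∈ S, -s ∈ S)
    (hG : CirculantRank.IsConsecutiveCirculant
      (SimpleGraph.circulantGraph (S : Set (ZMod n)))) :
    CirculantRank.mscrReal (SimpleGraph.circulantGraph (S : Set (ZMod n))) =
        CirculantRank.mscr (SimpleGraph.circulantGraph (S : Set (ZMod n))) ∧
      CirculantRank.mscr (SimpleGraph.circulantGraph (S : Set (ZMod n))) = n - S.card := by
  obtain ⟨k, hk1, hk, hG⟩ := hG
  have hkn : 2 * k < n := by
    obtain ⟨h, rfl⟩ := hn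
    omega
  obtain rfl := CirculantRank.eq_of_circulantGraph_eq hS0 hSneg
    (CirculantRank.zero_notMem_consecutiveSet (by omega))
    (fun _ => CirculantRank.neg_mem_consecutiveSet) hG
  rw [CirculantRank.card_consecutiveSet hkn]
  have hreal := CirculantRank.minSemidefiniteCirculantRank_consecutiveSet ℝ hn hk1 hk
  have hcomplex := CirculantRank.minSemidefiniteCirculantRank_consecutiveSet ℂ hn hk1 hk
  exact ⟨hreal.trans hcomplex.symm, hcomplex⟩
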